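/- \textbf{Lemma (State-uniform PAC one-step safety guarantee).} Let $\mathbb{D}\subset\mathbb{R}^q$ be compact, let $\mathrm{P}_d$ be a Borel probability measure on $\mathbb{D}$, and let $f:\mathbb{R}^n\times\mathbb{D}\to\mathbb{R}^n$ be continuous. Let $\mathbb{X}\subset\mathbb{R}^n$ be compact and let $\widehat{\mathbb{X}}\subset\mathbb{R}^n$ be a compact set containing $\mathbb{X}$ and $f(x,d)$ for all $x\in\mathbb{X}$, $d\in\mathbb{D}$. Let $h:\mathbb{R}^m\times\mathbb{R}^n\to\mathbb{R}$ be continuous and such that $a\mapsto h(a,x)$ is linear for every $x\in\mathbb{R}^n$ (in particular $h(0,x)=0$). Let $\gamma,\epsilon,\delta\in(0,1)$, $U_a>0$, $N_o\ge 1$ and $x_1',\dots,x_{N_o}'\in\mathbb{X}$. For a sample $D^M=(d^{(1)},\dots,d^{(M)})\in\mathbb{D}^M$ consider the sampled program $$ \min_{a\in\mathbb{R}^m}\; -\frac1{N_o}\sum_{i=1}^{N_o}h(a,x_i') \quad\text{s.t.}\quad \begin{cases} h(a,x)\le 0, & \forall x\in\overline{\widehat{\mathbb{X}}\setminus\mathbb{X}},\\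 h(a,f(x,d^{(j)}))\ge\gamma\,h(a,x), & \forall x\in\mathbb{X},\ j=1,\dots,M,\\ a[l]\in[-U_a,U_a], & l=1,\dots,m. \end{cases} $$ For every $D^M\in\mathbb{D}^M$ let $a^*=a^*(D^M)$ be the optimal solution of this program; if optimal solutions are not always unique, $a^*(D^M)$ is the one selected by a tie-break rule fixed in advance: there are convex functions $t_1,\dots,t_p:\mathbb{R}^m\to\mathbb{R}$, not depending on $D^M$, such that for every $D^M$ minimizing $t_1$ over the optimal solutions, then $t_2$ over the remaining ones, and so on up to $t_p$, leaves exactly one point, namely $a^*(D^M)$. (The case $p=0$ is that of unique optimal solutions.) Put $\mathbb{X}_s=\{x\in\mathbb{X}: h(a^*(D^M),x)>0\}$. If $$ M\;\ge\;\frac{2}{\epsilon}\Bigl(\ln\frac1\delta+m\Bigr), $$ then there is a measurable event of $\mathrm{P}_d^M$-probability at least $1-\delta$ such that for every sample $D^M$ in it the following holds: if $\mathbb{X}_s\ne\emptyset$, then $$ \mathrm{P}_d\bigl[h(a^*(D^M),f(x,d))\ge\gamma\,h(a^*(D^M),x)\bigr]\ge 1-\epsilon\quad\text{for all }x\in\mathbb{X},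 $$ and consequently $$ \mathrm{P}_d\bigl[f(x,d)\in\mathbb{X}_s\bigr]\ge 1-\epsilon\quad\text{for all }x\in\mathbb{X}_s . $$ -/

import Mathlib

open MeasureTheory

/-- The feasible set of the sampled program: the parameters `a` in the box `[-U, U]^m` for which
`h a` is nonpositive on the closure of `Xhat \ X` and satisfies the robust barrier inequality
on `X` for each of the disturbance samples `ω 0, …, ω (M - 1)`. -/
def sampledFeasible {n m q M : ℕ} {D : Set (EuclideanSpace ℝ (Fin q))}
    (f : EuclideanSpace ℝ (Fin n) → D → EuclideanSpace ℝ (Fin n))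
    (X Xhat : Set (EuclideanSpace ℝ (Fin n)))
    (h : EuclideanSpace ℝ (Fin m) → EuclideanSpace ℝ (Fin n) → ℝ)
    (γ U : ℝ) (ω : Fin M → D) : Set (EuclideanSpace ℝ (Fin m)) :=
  {a | (∀ x ∈ closure (Xhat \ X), h a x ≤ 0) ∧
       (∀ j : Fin M, ∀ x ∈ X, h a (f x (ω j)) ≥ γ * h a x) ∧
       (∀ l : Fin m, a l ∈ Set.Icc (-U) U)}

/-- The objective `-(1/N) ∑ i, h(a, x' i)`, to be minimized over `a`. -/
noncomputable def barrierObjective {n m N : ℕ}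
    (h : EuclideanSpace ℝ (Fin m) → EuclideanSpace ℝ (Fin n) → ℝ)
    (x' : Fin N → EuclideanSpace ℝ (Fin n)) (a : EuclideanSpace ℝ (Fin m)) : ℝ :=
  -((1 / (N : ℝ)) * ∑ i, h a (x' i))

/-- The set of (globally) optimal solutions of the sampled program. -/
def optimalSolutions {n m q M N : ℕ} {D : Set (EuclideanSpace ℝ (Fin q))}
    (f : EuclideanSpace ℝ (Fin n) → D → EuclideanSpace ℝ (Fin n))
    (X Xhat : Set (EuclideanSpace ℝ (Fin n)))
    (h : EuclideanSpace ℝ (Fin m) → EuclideanSpace ℝ (Fin n) → ℝ)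
    (γ U : ℝ) (x' : Fin N → EuclideanSpace ℝ (Fin n)) (ω : Fin M → D) :
    Set (EuclideanSpace ℝ (Fin m)) :=
  {a ∈ sampledFeasible f X Xhat h γ U ω |
    ∀ b ∈ sampledFeasible f X Xhat h γ U ω, barrierObjective h x' a ≤ barrierObjective h x' b}

/-- `a` is the element of `S` singled out by the tie-break functions `t 0, t 1, …, t (p - 1)`:
it minimizes `t 0` over `S`, among the minimizers of `t 0` it minimizes `t 1`, and so on, and
after the last step no other candidate is left.
With `p = 0` this says that `a` is the only element of `S`. -/
def IsTieBreakChoice {m p : ℕ} (t : Fin p → EuclideanSpace ℝ (Fin m) → ℝ)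
    (S : Set (EuclideanSpace ℝ (Fin m))) (a : EuclideanSpace ℝ (Fin m)) : Prop :=
  a ∈ S ∧ ∀ b ∈ S, b ≠ a → ∃ k : Fin p, (∀ i < k, t i a = t i b) ∧ t k a < t k b

/-- The certified set `X_s = {x ∈ X | h(a, x) > 0}`. -/
def certifiedSet {n m : ℕ} (X : Set (EuclideanSpace ℝ (Fin n)))
    (h : EuclideanSpace ℝ (Fin m) → EuclideanSpace ℝ (Fin n) → ℝ)
    (a : EuclideanSpace ℝ (Fin m)) : Set (EuclideanSpace ℝ (Fin n)) :=
  {x ∈ X | h a x > 0}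

/-! The training map `aStar` is a stable compression scheme. Objective and tie-breaks make `aStar ω`
the unique lexicographic minimizer of convex functions over an intersection of convex sets, one per
sample. The strictly better parameters form a convex set missing that intersection, so by Helly's
theorem at most `m` samples exclude them all (`exists_card_le_finrank_forall_notMem`); resampling
that keeps these samples keeps the output.

Call `ω` bad if its output violates the barrier inequality somewhere on `X` with probability above
`ε`. For a fixed index set `T`, a bad output computed from the samples in `T` passes the remaining
independent tests with probability at most `(1 - ε) ^ (M - |T|)`. A bad `ω` is caught by every `T`
containing its compression set, hence by at least `2 ^ (M - m)` sets, while the bounds sum to `(2 -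
ε) ^ M`. So bad samples have probability at most `2 ^ m * (1 - ε / 2) ^ M`
(`measureReal_pi_lt_one_sub_le`). Measurability of `aStar` comes from `measurable_of_lexLT`. Each
test demands the inequality for all `x ∈ X` at once, so uniformity in `x` is free. -/

/-! ### Lexicographic comparison by convex functions. -/

/-- `a` is strictly smaller than `b` for the lexicographic order on the values of the finite
sequence of functions `u`. -/
def LexLT {E : Type*} {k : ℕ} (u : Fin k → E → ℝ) (a b : E) : Prop :=
  ∃ i, (∀ j < i, u j a = u j b) ∧ u i a < u i b

namespace LexLT

variable {E : Type*} {k : ℕ} {u : Fin k → E → ℝ}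

theorem irrefl (a : E) : ¬ LexLT u a a := fun ⟨_, _, hi⟩ => lt_irrefl _ hi

theorem asymm {a b : E} (hab : LexLT u a b) : ¬ LexLT u b a := by
  rintro ⟨j, hj, hj'⟩
  obtain ⟨i, hi, hi'⟩ := hab
  rcases lt_trichotomy i j with hij | rfl | hij
  · exact hi'.ne' (hj i hij)
  · exact lt_asymm hi' hj'
  · exact hj'.ne' (hi j hij)

/-- If `a` is dominated by `b` up to the index `i`, strictly at `i`, then it is lexicographically
smaller. -/
theorem of_le {a b : E} {i : Fin k} (hle : ∀ j < i, u j a ≤ u j b) (hlt : u i a < u i b) :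
    LexLT u a b := by
  classical
  let S : Finset (Fin k) := Finset.univ.filter fun j => u j a < u j b
  have hS : S.Nonempty := ⟨i, by simpa [S] using hlt⟩
  have hmem : S.min' hS ∈ S := S.min'_mem hS
  refine ⟨S.min' hS, fun j hj => ?_, by simpa [S] using hmem⟩
  have hji : j < i := hj.trans_le (S.min'_le i (by simpa [S] using hlt))
  refine le_antisymm (hle j hji) (not_lt.1 fun hlt' => ?_)
  exact absurd (S.min'_le j (by simpa [S] using hlt')) (not_le.2 hj)

/-- Strict lexicographic sublevel sets of convex functions are convex. -/
theorem convex_setOf [AddCommGroup E] [Module ℝ E] (hu : ∀ i, ConvexOn ℝ Set.univ (u i)) (v : E) :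
    Convex ℝ {a | LexLT u a v} := by
  -- Both weights must be positive: at the index `min i j` possibly only one of the two points is
  -- strictly better than `v`.
  rw [convex_iff_forall_pos]
  rintro a ⟨i, hi, hi'⟩ b ⟨j, hj, hj'⟩ s r hs hr hsr
  have key : ∀ l, u l (s • a + r • b) ≤ s * u l a + r * u l b := fun l => by
    simpa using (hu l).2 (Set.mem_univ a) (Set.mem_univ b) hs.le hr.le hsr
  have hv : ∀ l, s * u l v + r * u l v = u l v := fun l => by rw [← add_mul, hsr, one_mul]
  have hle : ∀ l ≤ min i j, u l a ≤ u l v ∧ u l b ≤ u l v := by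
    intro l hl
    constructor
    · rcases (hl.trans (min_le_left _ _)).lt_or_eq with h | rfl
      exacts [(hi l h).le, hi'.le]
    · rcases (hl.trans (min_le_right _ _)).lt_or_eq with h | rfl
      exacts [(hj l h).le, hj'.le]
  refine of_le (i := min i j) (fun l hl => ?_) ?_
  · refine (key l).trans ?_
    rw [← hv l]
    obtain ⟨h1, h2⟩ := hle l hl.le
    gcongr
  · refine (key _).trans_lt ?_
    rw [← hv]
    obtain ⟨h1, h2⟩ := hle _ le_rfl
    rcases min_choice i j with h | h
    · have h3 : u (min i j) a < u (min i j) v := by rw [h]; exact hi'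
      exact add_lt_add_of_lt_of_le (by gcongr) (by gcongr)
    · have h3 : u (min i j) b < u (min i j) v := by rw [h]; exact hj'
      exact add_lt_add_of_le_of_lt (by gcongr) (by gcongr)

end LexLT

/-! ### Measurable selection. -/

/-- Measurable dependence of lexicographic minimizers: if a compact-valued multifunction `F` has
measurable preimages of closed sets and `A ω` is the unique lexicographic minimizer over `F ω` of a
finite sequence of continuous functions, then `A` is measurable. -/
theorem measurable_of_lexLT {Ω E : Type*} [MeasurableSpace Ω] [TopologicalSpace E]
    [MeasurableSpace E] [BorelSpace E] [T2Space E] {k : ℕ} {u : Fin k → E → ℝ}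
    (hu : ∀ i, Continuous (u i)) {F : Ω → Set E} (hF : ∀ ω, IsCompact (F ω))
    (hmeas : ∀ K, IsClosed K → MeasurableSet {ω | (F ω ∩ K).Nonempty})
    {A : Ω → E} (hA : ∀ ω, A ω ∈ F ω) (hlex : ∀ ω, ∀ b ∈ F ω, b ≠ A ω → LexLT u (A ω) b) :
    Measurable A := by
  -- Minimizers after `i` stages, decreasing from `F ω` at `i = 0` to `{A ω}` at `i = k`;
  -- hit-measurability is passed on stage by stage.
  let G : ℕ → Ω → Set E := fun i ω => {a ∈ F ω | ∀ j : Fin k, j.1 < i → u j a = u j (A ω)}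
  have hGcompact : ∀ i ω, IsCompact (G i ω) := by
    intro i ω
    have : G i ω = F ω ∩ ⋂ j : Fin k, ⋂ _ : j.1 < i, {a | u j a = u j (A ω)} := by
      ext a; simp [G]
    rw [this]
    exact (hF ω).inter_right (isClosed_iInter fun j => isClosed_iInter fun _ =>
      isClosed_eq (hu j) continuous_const)
  have hmin : ∀ (i : Fin k) ω, ∀ b ∈ G i ω, u i (A ω) ≤ u i b := by
    rintro i ω b ⟨hb, hb'⟩
    by_cases hbA : b = A ω
    · rw [hbA]
    obtain ⟨l, hl, hl'⟩ := hlex ω b hb hbA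
    rcases lt_trichotomy l i with h | rfl | h
    · exact absurd (hb' l h) hl'.ne'
    · exact hl'.le
    · exact (hl i h).le
  have hG : ∀ i ≤ k, ∀ K, IsClosed K → MeasurableSet {ω | (G i ω ∩ K).Nonempty} := by
    intro i
    induction i with
    | zero => intro _ K hK; simpa [G] using hmeas K hK
    | succ i ih =>
      intro hi K hK
      have ih := ih (by omega)
      let i' : Fin k := ⟨i, hi⟩
      have hsucc : ∀ ω b, b ∈ G (i + 1) ω ↔ b ∈ G i ω ∧ u i' b = u i' (A ω) := by
        intro ω b
        simp only [G, Set.mem_ofPred_eq, and_assoc, and_congr_right_iff]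
        intro _
        constructor
        · exact fun h => ⟨fun j hj => h j (by omega), h i' (Nat.lt_succ_self i)⟩
        · rintro ⟨h, h'⟩ j hj
          rcases (Nat.lt_succ_iff.1 hj).lt_or_eq with hj | hj
          · exact h j hj
          · have : j = i' := Fin.ext hj
            rw [this, h']
      have hclosed : ∀ r : ℝ, IsClosed {a | u i' a ≤ r} :=
        fun r => isClosed_le (hu i') continuous_const
      -- `K` contains a minimizer of `u i'` over `G i ω` iff every rational sublevel set that meets
      -- `G i ω` does so inside `K`; compactness yields the minimizer from the rational levels.
      have heq : {ω | (G (i + 1) ω ∩ K).Nonempty} = ⋂ r : ℚ,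
          {ω | (G i ω ∩ {a | u i' a ≤ r}).Nonempty → (G i ω ∩ (K ∩ {a | u i' a ≤ r})).Nonempty} := by
        ext ω
        simp only [Set.mem_iInter, Set.mem_ofPred_eq]
        constructor
        · rintro ⟨b, hb, hbK⟩ r ⟨c, hc, hcr⟩
          obtain ⟨hb1, hb2⟩ := (hsucc ω b).1 hb
          exact ⟨b, hb1, hbK, hb2.le.trans ((hmin i' ω c hc).trans hcr)⟩
        · intro h
          have hAG : A ω ∈ G i ω := ⟨hA ω, fun _ _ => rfl⟩
          have hr : ∀ r : ℚ, u i' (A ω) < r → (G i ω ∩ (K ∩ {a | u i' a ≤ r})).Nonempty :=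
            fun r hr => h r ⟨A ω, hAG, hr.le⟩
          obtain ⟨r₀, hr₀⟩ := exists_rat_gt (u i' (A ω))
          have hne : (G i ω ∩ K).Nonempty :=
            (hr r₀ hr₀).mono fun a ha => ⟨ha.1, ha.2.1⟩
          obtain ⟨b, ⟨hb, hbK⟩, hbmin⟩ :=
            ((hGcompact i ω).inter_right hK).exists_isMinOn hne (hu i').continuousOn
          refine ⟨b, (hsucc ω b).2 ⟨hb, le_antisymm ?_ (hmin i' ω b hb)⟩, hbK⟩
          refine le_of_forall_lt_rat_imp_le fun r hlt => ?_
          obtain ⟨c, hc, hcK, hcr⟩ := hr r hlt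
          exact (hbmin ⟨hc, hcK⟩ : u i' b ≤ u i' c).trans hcr
      rw [heq]
      refine MeasurableSet.iInter fun r => ?_
      exact (ih _ (hclosed r)).imp (ih _ (hK.inter (hclosed r)))
  refine measurable_of_isClosed fun K hK => ?_
  convert hG k le_rfl K hK using 1
  ext ω
  constructor
  · exact fun h => ⟨A ω, ⟨hA ω, fun _ _ => rfl⟩, h⟩
  · rintro ⟨b, ⟨hb, hb'⟩, hbK⟩
    by_cases hbA : b = A ω
    · rwa [hbA] at hbK
    · obtain ⟨l, -, hl⟩ := hlex ω b hb hbA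
      exact absurd (hb' l l.2) hl.ne'

/-! ### Helly's theorem and support constraints. -/

/-- Helly-type theorem for convex programs: if no point of a convex set `W` satisfies all of the
finitely many convex constraints `C j`, which have a common point, then at most `finrank ℝ E` of
the constraints suffice to rule out the points of `W`. -/
theorem exists_card_le_finrank_forall_notMem {E ι : Type*} [AddCommGroup E] [Module ℝ E]
    [FiniteDimensional ℝ E] [Fintype ι] [Nonempty ι] (hE : 0 < Module.finrank ℝ E)
    {C : ι → Set E} (hC : ∀ j, Convex ℝ (C j)) {W : Set E} (hW : Convex ℝ W)
    {a : E} (ha : ∀ j, a ∈ C j) (hempty : ∀ b ∈ W, ∃ j, b ∉ C j) :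
    ∃ B : Finset ι, B.Nonempty ∧ B.card ≤ Module.finrank ℝ E ∧ ∀ b ∈ W, ∃ j ∈ B, b ∉ C j := by
  classical
  by_contra! hcon
  -- `none` stands for `W`: among `finrank + 1` sets including `W`, at most `finrank` are
  -- constraints; without `W`, `a` is a common point.
  let F : Option ι → Set E := fun o => o.elim W C
  have hconv : ∀ o ∈ (Finset.univ : Finset (Option ι)), Convex ℝ (F o) := by
    rintro (_ | j) -
    exacts [hW, hC j]
  obtain ⟨b, hb⟩ := Convex.helly_theorem' (𝕜 := ℝ) hconv (by
    intro I _ hI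
    by_cases hnone : none ∈ I
    · obtain ⟨B, hB, hBcard, hIB⟩ : ∃ B : Finset ι, B.Nonempty ∧ B.card ≤ Module.finrank ℝ E ∧
          ∀ j, some j ∈ I → j ∈ B := by
        have hcard : I.eraseNone.card + 1 = I.card := by
          rw [Finset.card_eraseNone_of_mem hnone]
          exact Nat.sub_add_cancel (Finset.card_pos.2 ⟨_, hnone⟩)
        rcases I.eraseNone.eq_empty_or_nonempty with h | h
        · obtain ⟨j₀⟩ := ‹Nonempty ι›
          refine ⟨{j₀}, by simp, by rwa [Finset.card_singleton], fun j hj => ?_⟩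
          rw [← Finset.mem_eraseNone, h] at hj
          simp at hj
        · exact ⟨I.eraseNone, h, by omega, fun j hj => Finset.mem_eraseNone.2 hj⟩
      obtain ⟨b, hbW, hbB⟩ := hcon B hB hBcard
      refine ⟨b, Set.mem_iInter₂.2 ?_⟩
      rintro (_ | j) hj
      exacts [hbW, hbB j (hIB j hj)]
    · refine ⟨a, Set.mem_iInter₂.2 ?_⟩
      rintro (_ | j) hj
      exacts [absurd hj hnone, ha j])
  have hb' : ∀ o, b ∈ F o := fun o => Set.mem_iInter₂.1 hb o (Finset.mem_univ o)
  obtain ⟨j, hj⟩ := hempty b (hb' none)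
  exact hj (hb' (some j))

/-! ### Generalization by compression. -/

open Classical in
/-- Generalization bound for stable compression schemes. A map `A` is trained on `M` i.i.d. samples
and its output is consistent with all of them. If every training sequence has at most `m` entries
such that any resampling of the sequence that keeps those entries yields the same output, then the
output is unlikely to be consistent with a fresh sample with probability less than `1 - ε`. -/
theorem measureReal_pi_lt_one_sub_le {D E : Type*} [MeasurableSpace D] [MeasurableSpace E]
    (P : Measure D) [IsProbabilityMeasure P] {M m : ℕ} {A : (Fin M → D) → E} (hA : Measurable A)
    {C : Set (E × D)} (hC : MeasurableSet C) (hcons : ∀ ω j, (A ω, ω j) ∈ C)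
    (hstable : ∀ ω, ∃ B : Finset (Fin M), B.Nonempty ∧ B.card ≤ m ∧
      ∀ r : Fin M → Fin M, (∀ j ∈ B, r j = j) → A (ω ∘ r) = A ω)
    {ε : ℝ} (hε : ε ≤ 1) :
    MeasurableSet {ω | P.real {d | (A ω, d) ∈ C} < 1 - ε} ∧
    (Measure.pi fun _ : Fin M => P).real {ω | P.real {d | (A ω, d) ∈ C} < 1 - ε} ≤
      2 ^ m * (1 - ε / 2) ^ M := by
  set g : E → ℝ := fun a => P.real {d | (a, d) ∈ C}
  have hg : Measurable g := (measurable_measure_prodMk_left hC).ennreal_toReal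
  set π := Measure.pi fun _ : Fin M => P
  set bad : Set (Fin M → D) := {ω | g (A ω) < 1 - ε}
  have hbad : MeasurableSet bad := measurableSet_lt (hg.comp hA) measurable_const
  refine ⟨hbad, ?_⟩
  -- for `T` nonempty, `r T` maps `Fin M` onto `T` and fixes its elements
  obtain ⟨r, hrT, hr⟩ : ∃ r : Finset (Fin M) → Fin M → Fin M,
      (∀ T, T.Nonempty → ∀ j, r T j ∈ T) ∧ ∀ T, ∀ j ∈ T, r T j = j := by
    refine ⟨fun T j => if hT : T.Nonempty then if j ∈ T then j else hT.choose else j, ?_, ?_⟩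
    · intro T hT j
      by_cases hj : j ∈ T
      · simp [hT, hj]
      · simpa [hT, hj] using hT.choose_spec
    · intro T j hj
      simp [hj]
  -- The output trained on `T` alone is bad, yet consistent with all samples outside `T`.
  let badT : Finset (Fin M) → Set (Fin M → D) := fun T =>
    {ω | T.Nonempty ∧ g (A (ω ∘ r T)) < 1 - ε ∧ ∀ j ∉ T, (A (ω ∘ r T), ω j) ∈ C}
  have hcomp : ∀ T, Measurable fun ω : Fin M → D => A (ω ∘ r T) := fun T =>
    hA.comp (measurable_pi_lambda _ fun j => measurable_pi_apply _)
  have hbadT : ∀ T, MeasurableSet (badT T) := by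
    intro T
    refine (MeasurableSet.const _).inter
      ((measurableSet_lt (hg.comp (hcomp T)) measurable_const).inter ?_)
    have : {ω : Fin M → D | ∀ j ∉ T, (A (ω ∘ r T), ω j) ∈ C} =
        ⋂ j : Fin M, ⋂ _ : j ∉ T, (fun ω => (A (ω ∘ r T), ω j)) ⁻¹' C := by
      ext ω; simp
    change MeasurableSet {ω : Fin M → D | ∀ j ∉ T, (A (ω ∘ r T), ω j) ∈ C}
    rw [this]
    exact MeasurableSet.iInter fun j => MeasurableSet.iInter fun _ =>
      ((hcomp T).prodMk (measurable_pi_apply j)) hC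
  -- an output computed from the samples in `T` is tested by the other, independent, samples
  have hbound : ∀ T, π (badT T) ≤ ENNReal.ofReal (1 - ε) ^ (M - T.card) := by
    intro T
    rcases T.eq_empty_or_nonempty with rfl | hT
    · have : badT ∅ = ∅ := by ext ω; simp [badT]
      simp [this]
    let e := MeasurableEquiv.piEquivPiSubtypeProd (fun _ : Fin M => D) (· ∈ T)
    have he : MeasurePreserving e π _ :=
      measurePreserving_piEquivPiSubtypeProd (fun _ : Fin M => P) (· ∈ T)
    let φ : ({j // j ∈ T} → D) → E := fun y => A fun j => y ⟨r T j, hrT T hT j⟩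
    have hφ : Measurable φ :=
      hA.comp (measurable_pi_lambda _ fun j => measurable_pi_apply _)
    let S : Set (({j // j ∈ T} → D) × ({j // j ∉ T} → D)) :=
      {z | g (φ z.1) < 1 - ε ∧ ∀ j, (φ z.1, z.2 j) ∈ C}
    have hpre : badT T = e ⁻¹' S := by
      ext ω
      have h1 : φ (e ω).1 = A (ω ∘ r T) := rfl
      have h2 : ∀ j, (e ω).2 j = ω j := fun j => rfl
      simp only [badT, S, Set.mem_ofPred_eq, Set.mem_preimage, hT, true_and, h1, h2,
        Subtype.forall]
    have hS : MeasurableSet S := by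
      refine (measurableSet_lt (hg.comp (hφ.comp measurable_fst)) measurable_const).inter ?_
      change MeasurableSet {z : ({j // j ∈ T} → D) × ({j // j ∉ T} → D) |
        ∀ j, (φ z.1, z.2 j) ∈ C}
      rw [Set.ofPred_forall]
      exact MeasurableSet.iInter fun j =>
        ((hφ.comp measurable_fst).prodMk ((measurable_pi_apply j).comp measurable_snd)) hC
    rw [hpre, he.measure_preimage hS.nullMeasurableSet, Measure.prod_apply hS]
    have hsec : ∀ y, (Measure.pi fun _ : {j // j ∉ T} => P) (Prod.mk y ⁻¹' S) ≤
        ENNReal.ofReal (1 - ε) ^ (M - T.card) := by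
      intro y
      by_cases hy : g (φ y) < 1 - ε
      · have : Prod.mk y ⁻¹' S = Set.univ.pi fun _ : {j // j ∉ T} => {d | (φ y, d) ∈ C} := by
          ext z; simp [S, hy]
        rw [this, Measure.pi_pi, Finset.prod_const]
        have hcard : (Finset.univ : Finset {j // j ∉ T}).card = M - T.card := by
          rw [Finset.card_univ, Fintype.card_subtype_compl]
          simp
        rw [hcard]
        gcongr
        rw [← ofReal_measureReal (measure_ne_top _ _)]
        exact ENNReal.ofReal_le_ofReal hy.le
      · have : Prod.mk y ⁻¹' S = ∅ := by
          ext z; simp [S, hy]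
        simp [this]
    exact (lintegral_mono hsec).trans (by simp)
  -- every bad sequence is detected by at least `2 ^ (M - m)` of the sets `T`
  have hcount : ∀ ω ∈ bad, (2 : ENNReal) ^ (M - m) ≤
      ∑ T : Finset (Fin M), (badT T).indicator 1 ω := by
    intro ω hω
    obtain ⟨B, hB, hBm, hBst⟩ := hstable ω
    calc (2 : ENNReal) ^ (M - m) ≤ 2 ^ (M - B.card) := by
          gcongr
          norm_num
      _ = ∑ T ∈ Finset.Icc B Finset.univ, (1 : ENNReal) := by
          rw [Finset.sum_const, Finset.card_Icc_finset (Finset.subset_univ B)]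
          simp
      _ ≤ ∑ T ∈ Finset.Icc B Finset.univ, (badT T).indicator 1 ω := by
          refine Finset.sum_le_sum fun T hT => ?_
          have hBT : B ⊆ T := (Finset.mem_Icc.1 hT).1
          have hAT : A (ω ∘ r T) = A ω := hBst _ fun j hj => hr T j (hBT hj)
          have hmem : ω ∈ badT T :=
            ⟨hB.mono hBT, by rw [hAT]; exact hω, fun j _ => by rw [hAT]; exact hcons ω j⟩
          simp [hmem]
      _ ≤ _ := Finset.sum_le_sum_of_subset (Finset.subset_univ _)
  -- Double counting: integrate `hcount`, bound each `badT T`, and sum over all `T` by the binomial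
  -- theorem.
  have hmain : (2 : ENNReal) ^ (M - m) * π bad ≤ ENNReal.ofReal ((2 - ε) ^ M) := by
    calc (2 : ENNReal) ^ (M - m) * π bad
        = ∫⁻ ω, bad.indicator (fun _ => 2 ^ (M - m)) ω ∂π := by
          rw [lintegral_indicator_const hbad]
      _ ≤ ∫⁻ ω, ∑ T : Finset (Fin M), (badT T).indicator 1 ω ∂π := by
          refine lintegral_mono fun ω => ?_
          by_cases hω : ω ∈ bad
          · simpa [hω] using hcount ω hω
          · simp [hω]
      _ = ∑ T : Finset (Fin M), π (badT T) := by
          rw [lintegral_finsetSum _ fun T _ => measurable_one.indicator (hbadT T)]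
          simp [hbadT]
      _ ≤ ∑ T : Finset (Fin M), 1 ^ T.card * ENNReal.ofReal (1 - ε) ^ (M - T.card) :=
          Finset.sum_le_sum fun T _ => by simpa using hbound T
      _ = ENNReal.ofReal ((2 - ε) ^ M) := by
          rw [Fin.sum_pow_mul_eq_add_pow, ← ENNReal.ofReal_one,
            ← ENNReal.ofReal_add zero_le_one (by linarith), ENNReal.ofReal_pow (by linarith)]
          ring_nf
  have hreal : (2 : ℝ) ^ (M - m) * π.real bad ≤ (2 - ε) ^ M := by
    have := ENNReal.toReal_mono ENNReal.ofReal_ne_top hmain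
    rwa [ENNReal.toReal_ofReal (by apply pow_nonneg; linarith), ENNReal.toReal_mul,
      ENNReal.toReal_pow] at this
  -- Only an inequality, since `M - m` truncates to `0` when `M < m`.
  have hpow : (2 : ℝ) ^ M ≤ 2 ^ (M - m) * 2 ^ m := by
    rw [← pow_add]
    exact pow_le_pow_right₀ one_le_two (by omega)
  have h2 : (2 - ε) ^ M = 2 ^ M * (1 - ε / 2) ^ M := by rw [← mul_pow]; ring_nf
  have h3 : 0 ≤ (1 - ε / 2) ^ M := pow_nonneg (by linarith) _
  refine le_of_mul_le_mul_left (hreal.trans ?_) (by positivity : (0 : ℝ) < 2 ^ (M - m))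
  rw [h2, ← mul_assoc]
  exact mul_le_mul_of_nonneg_right hpow h3

/-! ### Convexity and compactness of the sampled program. -/

/-- The points of the box `[-U, U]^m` at which `h` is nonpositive on the closure of `Xhat \ X` and
which satisfy the barrier inequality for the disturbance `d`. -/
def singleFeasible {n m q : ℕ} {D : Set (EuclideanSpace ℝ (Fin q))}
    (f : EuclideanSpace ℝ (Fin n) → D → EuclideanSpace ℝ (Fin n))
    (X Xhat : Set (EuclideanSpace ℝ (Fin n)))
    (h : EuclideanSpace ℝ (Fin m) → EuclideanSpace ℝ (Fin n) → ℝ)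
    (γ U : ℝ) (d : D) : Set (EuclideanSpace ℝ (Fin m)) :=
  {a | (∀ x ∈ closure (Xhat \ X), h a x ≤ 0) ∧ (∀ x ∈ X, h a (f x d) ≥ γ * h a x) ∧
       (∀ l : Fin m, a l ∈ Set.Icc (-U) U)}

section SampledProgram

variable {n m q M N p : ℕ} {D : Set (EuclideanSpace ℝ (Fin q))}
  {f : EuclideanSpace ℝ (Fin n) → D → EuclideanSpace ℝ (Fin n)}
  {X Xhat : Set (EuclideanSpace ℝ (Fin n))}
  {h : EuclideanSpace ℝ (Fin m) → EuclideanSpace ℝ (Fin n) → ℝ} {γ U : ℝ}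

/-- Attaching the sample-independent constraints to every sample leaves one convex set per sample
for Helly. With no samples these constraints would be lost. -/
theorem mem_sampledFeasible_iff [Nonempty (Fin M)] {ω : Fin M → D}
    {a : EuclideanSpace ℝ (Fin m)} :
    a ∈ sampledFeasible f X Xhat h γ U ω ↔ ∀ j, a ∈ singleFeasible f X Xhat h γ U (ω j) := by
  constructor
  · rintro ⟨h1, h2, h3⟩ j
    exact ⟨h1, h2 j, h3⟩
  · intro ha
    obtain ⟨j₀⟩ := ‹Nonempty (Fin M)›
    exact ⟨(ha j₀).1, fun j => (ha j).2.1, (ha j₀).2.2⟩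

theorem convex_singleFeasible (hlin : ∀ x, IsLinearMap ℝ (fun a => h a x)) (d : D) :
    Convex ℝ (singleFeasible f X Xhat h γ U d) := by
  intro a ⟨ha1, ha2, ha3⟩ b ⟨hb1, hb2, hb3⟩ s r hs hr hsr
  have hh : ∀ x, h (s • a + r • b) x = s * h a x + r * h b x := fun x => by
    rw [(hlin x).map_add, (hlin x).map_smul, (hlin x).map_smul, smul_eq_mul, smul_eq_mul]
  refine ⟨fun x hx => ?_, fun x hx => ?_, fun l => ?_⟩
  · rw [hh]
    nlinarith [mul_nonneg hs (neg_nonneg.2 (ha1 x hx)), mul_nonneg hr (neg_nonneg.2 (hb1 x hx))]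
  · rw [hh, hh]
    nlinarith [mul_nonneg hs (sub_nonneg.2 (ha2 x hx)), mul_nonneg hr (sub_nonneg.2 (hb2 x hx))]
  · exact convex_Icc (-U) U (ha3 l) (hb3 l) hs hr hsr

theorem isClosed_setOf_barrier (hf : Continuous (Function.uncurry f))
    (hcont : Continuous (Function.uncurry h)) :
    IsClosed {z : EuclideanSpace ℝ (Fin m) × D | ∀ x ∈ X, h z.1 (f x z.2) ≥ γ * h z.1 x} := by
  simp only [Set.ofPred_forall]
  refine isClosed_iInter fun x => isClosed_iInter fun _ => isClosed_le ?_ ?_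
  · exact continuous_const.mul (hcont.comp (continuous_fst.prodMk continuous_const))
  · exact hcont.comp (continuous_fst.prodMk (hf.comp (continuous_const.prodMk continuous_snd)))

theorem isClosed_setOf_mem_sampledFeasible (hf : Continuous (Function.uncurry f))
    (hcont : Continuous (Function.uncurry h)) :
    IsClosed {z : (Fin M → D) × EuclideanSpace ℝ (Fin m) |
      z.2 ∈ sampledFeasible f X Xhat h γ U z.1} := by
  have h1 : IsClosed {z : (Fin M → D) × EuclideanSpace ℝ (Fin m) |
      ∀ x ∈ closure (Xhat \ X), h z.2 x ≤ 0} := by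
    simp only [Set.ofPred_forall]
    exact isClosed_iInter fun x => isClosed_iInter fun _ => isClosed_le
      (hcont.comp (continuous_snd.prodMk continuous_const)) continuous_const
  have h2 : IsClosed {z : (Fin M → D) × EuclideanSpace ℝ (Fin m) |
      ∀ j : Fin M, ∀ x ∈ X, h z.2 (f x (z.1 j)) ≥ γ * h z.2 x} := by
    rw [Set.ofPred_forall]
    exact isClosed_iInter fun j =>
      (isClosed_setOf_barrier (X := X) (γ := γ) hf hcont).preimage
        (f := fun z : (Fin M → D) × EuclideanSpace ℝ (Fin m) => (z.2, z.1 j)) (by fun_prop)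
  have h3 : IsClosed {z : (Fin M → D) × EuclideanSpace ℝ (Fin m) |
      ∀ l : Fin m, z.2 l ∈ Set.Icc (-U) U} := by
    rw [Set.ofPred_forall]
    exact isClosed_iInter fun l => isClosed_Icc.preimage (by fun_prop)
  exact h1.inter (h2.inter h3)

/-- A compact graph has compact fibres, and its closed parts project to compact sets of samples: the
two inputs of `measurable_of_lexLT`. -/
theorem isCompact_setOf_mem_sampledFeasible (hD : IsCompact D)
    (hf : Continuous (Function.uncurry f)) (hcont : Continuous (Function.uncurry h)) :
    IsCompact {z : (Fin M → D) × EuclideanSpace ℝ (Fin m) |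
      z.2 ∈ sampledFeasible f X Xhat h γ U z.1} := by
  have : CompactSpace D := isCompact_iff_compactSpace.1 hD
  have hbox : IsCompact {a : EuclideanSpace ℝ (Fin m) | ∀ l : Fin m, a l ∈ Set.Icc (-U) U} := by
    have : {a : EuclideanSpace ℝ (Fin m) | ∀ l : Fin m, a l ∈ Set.Icc (-U) U} =
        (EuclideanSpace.equiv (Fin m) ℝ).toHomeomorph ⁻¹' Set.univ.pi fun _ => Set.Icc (-U) U := by
      ext a
      simp only [Set.mem_ofPred_eq, Set.mem_preimage, Set.mem_univ_pi]
      rfl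
    rw [this, Homeomorph.isCompact_preimage]
    exact isCompact_univ_pi fun _ => isCompact_Icc
  exact (isCompact_univ.prod hbox).of_isClosed_subset
    (isClosed_setOf_mem_sampledFeasible hf hcont) fun z hz => ⟨Set.mem_univ _, hz.2.2⟩

/-- The solution selected by the tie-break rule is the lexicographic minimizer of the objective
followed by the tie-break functions. -/
theorem lexLT_of_isTieBreakChoice {x' : Fin N → EuclideanSpace ℝ (Fin n)}
    {t : Fin p → EuclideanSpace ℝ (Fin m) → ℝ} {ω : Fin M → D} {a b : EuclideanSpace ℝ (Fin m)}
    (ha : IsTieBreakChoice t (optimalSolutions f X Xhat h γ U x' ω) a)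
    (hb : b ∈ sampledFeasible f X Xhat h γ U ω) (hba : b ≠ a) :
    LexLT (Fin.cons (barrierObjective h x') t : Fin (p + 1) → EuclideanSpace ℝ (Fin m) → ℝ)
      a b := by
  obtain ⟨⟨-, hmin⟩, htie⟩ := ha
  rcases (hmin b hb).lt_or_eq with hlt | heq
  · exact ⟨0, fun j hj => absurd hj (Fin.not_lt_zero j), hlt⟩
  · obtain ⟨k, hk, hk'⟩ := htie b ⟨hb, fun c hc => heq ▸ hmin c hc⟩ hba
    refine ⟨k.succ, fun j hj => ?_, hk'⟩
    induction j using Fin.cases with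
    | zero => exact heq
    | succ i => exact hk i (Fin.succ_lt_succ_iff.1 hj)

theorem convexOn_barrierObjective (hlin : ∀ x, IsLinearMap ℝ (fun a => h a x))
    (x' : Fin N → EuclideanSpace ℝ (Fin n)) : ConvexOn ℝ Set.univ (barrierObjective h x') := by
  refine ⟨convex_univ, fun a _ b _ s r _ _ _ => le_of_eq ?_⟩
  have hh : ∀ x, h (s • a + r • b) x = s * h a x + r * h b x := fun x => by
    rw [(hlin x).map_add, (hlin x).map_smul, (hlin x).map_smul, smul_eq_mul, smul_eq_mul]
  simp only [barrierObjective, hh, Finset.sum_add_distrib, ← Finset.mul_sum, smul_eq_mul]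
  ring

end SampledProgram

/-! ### Sample size and conclusion. -/

/-- Uses `2 ≤ e` and `1 - ε / 2 ≤ exp (-ε / 2)`; the first produces the summand `m` in the sample
size. -/
theorem two_pow_mul_one_sub_half_pow_le {m M : ℕ} {ε δ : ℝ} (hε : ε ∈ Set.Ioo (0 : ℝ) 1)
    (hδ : 0 < δ) (hM : (2 / ε) * (Real.log (1 / δ) + (m : ℝ)) ≤ (M : ℝ)) :
    2 ^ m * (1 - ε / 2) ^ M ≤ δ := by
  have h1 : (2 : ℝ) ≤ Real.exp 1 := by linarith [Real.add_one_le_exp (1 : ℝ)]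
  have h2 : 1 - ε / 2 ≤ Real.exp (-(ε / 2)) := by linarith [Real.add_one_le_exp (-(ε / 2))]
  have h3 : 0 ≤ 1 - ε / 2 := by linarith [hε.2]
  have h4 : m - M * (ε / 2) ≤ Real.log δ := by
    rw [div_mul_eq_mul_div, div_le_iff₀ hε.1, one_div, Real.log_inv] at hM
    linarith
  calc 2 ^ m * (1 - ε / 2) ^ M ≤ Real.exp 1 ^ m * Real.exp (-(ε / 2)) ^ M := by gcongr
    _ = Real.exp (m - M * (ε / 2)) := by
        rw [← Real.exp_nat_mul, ← Real.exp_nat_mul, ← Real.exp_add]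
        ring_nf
    _ ≤ Real.exp (Real.log δ) := Real.exp_le_exp.2 h4
    _ = δ := Real.exp_log hδ

theorem mainTheorem2
    {n m q M N p : ℕ}
    -- compact disturbance set, with an unknown (arbitrary) Borel probability measure on it
    (D : Set (EuclideanSpace ℝ (Fin q))) (hD : IsCompact D)
    (P : Measure D) [IsProbabilityMeasure P]
    -- dynamics, safe set, and a compact superset of the one-step reachable states
    (f : EuclideanSpace ℝ (Fin n) → D → EuclideanSpace ℝ (Fin n))
    (hf : Continuous (Function.uncurry f))
    (X Xhat : Set (EuclideanSpace ℝ (Fin n))) (hX : IsCompact X) (hXhat : IsCompact Xhat)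
    (hXXhat : X ⊆ Xhat) (hreach : ∀ x ∈ X, ∀ d : D, f x d ∈ Xhat)
    -- barrier template, linear in the parameter and continuous
    (h : EuclideanSpace ℝ (Fin m) → EuclideanSpace ℝ (Fin n) → ℝ)
    (hlin : ∀ x, IsLinearMap ℝ (fun a => h a x))
    (hcont : Continuous (Function.uncurry h))
    (γ ε δ U : ℝ) (hγ : γ ∈ Set.Ioo (0 : ℝ) 1) (hε : ε ∈ Set.Ioo (0 : ℝ) 1)
    (hδ : δ ∈ Set.Ioo (0 : ℝ) 1) (hU : 0 < U)
    -- the states at which the objective is evaluated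
    (hN : 0 < N) (x' : Fin N → EuclideanSpace ℝ (Fin n)) (hx' : ∀ i, x' i ∈ X)
    -- the optimal solution as a function of the samples; `t` breaks ties if there are any
    (t : Fin p → EuclideanSpace ℝ (Fin m) → ℝ) (ht : ∀ i, ConvexOn ℝ Set.univ (t i))
    (aStar : (Fin M → D) → EuclideanSpace ℝ (Fin m))
    (haStar : ∀ ω : Fin M → D,
      IsTieBreakChoice t (optimalSolutions f X Xhat h γ U x' ω) (aStar ω))
    (hM : (2 / ε) * (Real.log (1 / δ) + (m : ℝ)) ≤ (M : ℝ)) :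
    -- an event of probability at least `1 - δ` over the i.i.d. samples, on which the claims hold
    ∃ E : Set (Fin M → D), MeasurableSet E ∧
      1 - δ ≤ (Measure.pi (fun _ : Fin M => P)).real E ∧
      ∀ ω ∈ E, (certifiedSet X h (aStar ω)).Nonempty →
        (∀ x ∈ X, 1 - ε ≤ P.real {d : D | h (aStar ω) (f x d) ≥ γ * h (aStar ω) x}) ∧
        (∀ x ∈ certifiedSet X h (aStar ω),
          1 - ε ≤ P.real {d : D | f x d ∈ certifiedSet X h (aStar ω)}) := by
  -- For `m = 0` no nonempty compression set is small enough, but then `h` vanishes and the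
  -- certified set is empty.
  rcases Nat.eq_zero_or_pos m with rfl | hm
  · refine ⟨Set.univ, MeasurableSet.univ, by simpa using hδ.1.le, ?_⟩
    rintro ω - ⟨x, -, hx⟩
    rw [Subsingleton.elim (aStar ω) 0] at hx
    exact absurd (hlin x).map_zero hx.ne'
  have hMpos : 0 < M := by
    have h1 : 0 < Real.log (1 / δ) := Real.log_pos (by rw [lt_div_iff₀ hδ.1]; linarith [hδ.2])
    have h2 : 0 < 2 / ε := div_pos two_pos hε.1
    have h3 : (0 : ℝ) < M := (mul_pos h2 (by positivity)).trans_le hM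
    exact_mod_cast h3
  have : Nonempty (Fin M) := ⟨⟨0, hMpos⟩⟩
  let u : Fin (p + 1) → EuclideanSpace ℝ (Fin m) → ℝ := Fin.cons (barrierObjective h x') t
  have hu : ∀ i, ConvexOn ℝ Set.univ (u i) :=
    Fin.cases (convexOn_barrierObjective hlin x') ht
  have hfeas : ∀ ω, aStar ω ∈ sampledFeasible f X Xhat h γ U ω := fun ω => (haStar ω).1.1
  have hlex : ∀ ω, ∀ b ∈ sampledFeasible f X Xhat h γ U ω, b ≠ aStar ω → LexLT u (aStar ω) b :=
    fun ω b hb hne => lexLT_of_isTieBreakChoice (haStar ω) hb hne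
  have hcompact := isCompact_setOf_mem_sampledFeasible (M := M) (X := X) (Xhat := Xhat) (γ := γ)
    (U := U) hD hf hcont
  have hA : Measurable aStar := by
    refine measurable_of_lexLT (fun i => (hu i).locallyLipschitz.continuous)
      (F := fun ω => sampledFeasible f X Xhat h γ U ω) (fun ω => ?_) (fun K hK => ?_) hfeas hlex
    · have := (hcompact.inter_right (isClosed_singleton.preimage continuous_fst :
        IsClosed (Prod.fst ⁻¹' {ω}))).image continuous_snd
      refine Eq.mpr (congrArg IsCompact (Set.ext fun a => ?_)) this
      constructor
      · exact fun ha => ⟨(ω, a), ⟨ha, rfl⟩, rfl⟩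
      · rintro ⟨⟨ω', a'⟩, ⟨ha, rfl⟩, rfl⟩
        exact ha
    · have := (hcompact.inter_right (hK.preimage continuous_snd)).image continuous_fst
      convert this.isClosed.measurableSet using 1
      ext ω
      constructor
      · exact fun ⟨a, ha, haK⟩ => ⟨(ω, a), ⟨ha, haK⟩, rfl⟩
      · rintro ⟨⟨ω', a⟩, ⟨ha, haK⟩, rfl⟩
        exact ⟨a, ha, haK⟩
  have hstable : ∀ ω, ∃ B : Finset (Fin M), B.Nonempty ∧ B.card ≤ m ∧
      ∀ r : Fin M → Fin M, (∀ j ∈ B, r j = j) → aStar (ω ∘ r) = aStar ω := by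
    intro ω
    obtain ⟨B, hB, hBcard, hBW⟩ := exists_card_le_finrank_forall_notMem
      (by rwa [finrank_euclideanSpace_fin])
      (C := fun j => singleFeasible f X Xhat h γ U (ω j))
      (fun j => convex_singleFeasible hlin (ω j)) (LexLT.convex_setOf hu (aStar ω))
      (mem_sampledFeasible_iff.1 (hfeas ω)) (fun b hb => by
        by_contra! hcon
        have hbne : b ≠ aStar ω := by
          rintro rfl
          exact LexLT.irrefl _ hb
        exact (hlex ω b (mem_sampledFeasible_iff.2 hcon) hbne).asymm hb)
    rw [finrank_euclideanSpace_fin] at hBcard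
    refine ⟨B, hB, hBcard, fun r hr => ?_⟩
    by_contra hne
    -- The resampled program has no new constraints, so a different optimum would be strictly better
    -- than `aStar ω`; it then violates a constraint of `B`, which `r` retains.
    have hmem : aStar ω ∈ sampledFeasible f X Xhat h γ U (ω ∘ r) :=
      mem_sampledFeasible_iff.2 fun j => mem_sampledFeasible_iff.1 (hfeas ω) (r j)
    obtain ⟨j, hj, hjC⟩ := hBW _ (hlex _ _ hmem (Ne.symm hne))
    have hj' := mem_sampledFeasible_iff.1 (hfeas (ω ∘ r)) j
    rw [Function.comp_apply, hr j hj] at hj'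
    exact hjC hj'
  obtain ⟨hmeas, hle⟩ := measureReal_pi_lt_one_sub_le P hA
    (isClosed_setOf_barrier (X := X) (γ := γ) hf hcont).measurableSet
    (fun ω j => (hfeas ω).2.1 j) hstable hε.2.le
  refine ⟨_, hmeas.compl, ?_, fun ω hω _ => ?_⟩
  · rw [probReal_compl_eq_one_sub hmeas]
    linarith [two_pow_mul_one_sub_half_pow_le hε hδ.1 hM]
  · have hω' := not_lt.1 (Set.notMem_ofPred_iff.1 hω)
    refine ⟨fun x hx => hω'.trans (measureReal_mono fun d hd => hd x hx), fun x hx =>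
      hω'.trans (measureReal_mono fun d hd => ?_)⟩
    -- The successor lies in `Xhat` with `h > 0`, while `h ≤ 0` on `Xhat \ X`; hence it is in `X`.
    have hpos : 0 < h (aStar ω) (f x d) := (mul_pos hγ.1 hx.2).trans_le (hd x hx.1)
    refine ⟨?_, hpos⟩
    by_contra hnot
    exact hpos.not_ge ((hfeas ω).1 _ (subset_closure ⟨hreach x hx.1 d, hnot⟩))
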